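/- Let $p$ be an odd prime, let $q=p^k$ with $k\ge 1$, let $d\ge 2$ be an integer and let $t\in\mathbb{F}_q^\times$. Let $\omega$ be a generator of the group of characters $\mathbb{F}_q^\times\to\mathbb{C}^\times$, let $\phi$ be the unique such character of order $2$, and let $\zeta_p\in\mathbb{C}$ be a primitive $p$-th root of unity. For a character $\chi$ of $\mathbb{F}_q^\times$ define the Gauss sum $$g_q(\chi)=\sum_{x\in\mathbb{F}_q^\times}\chi(x)\,\zeta_p^{\mathrm{Tr}(x)},$$ where $\mathrm{Tr}:\mathbb{F}_q\to\mathbb{F}_p$ is the trace, and define the finite hypergeometric sum $$H_q(t)=\frac{(-1)^d}{1-q}\sum_{m=0}^{q-2}\left(\frac{g_q(\phi\,\omega^m)\,g_q(\omega^{-m})}{g_q(\phi)}\right)^d\omega\big((-1)^d t\big)^m .$$ Then the number of points $(x_1,\dots,x_d)\in(\mathbb{F}_q^\times)^d$ on the hypersurface $$\prod_{i=1}^d\left(x_i+2+x_i^{-1}\right)=4^d\,t^{-1}$$ equals $$\frac{(q-2)^d-(-1)^d}{q-1}-(-1)^d H_q(t).$$ -/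

import Mathlib

noncomputable section

namespace FiniteHypergeometric

variable {p : ℕ} [Fact p.Prime] (F : Type*) [Field F] [Algebra (ZMod p) F]

/-- The additive character `x ↦ ζ ^ Tr(x)` of the finite field `F` of characteristic `p`, where
`ζ` is a primitive `p`-th root of unity and `Tr` is the trace from `F` to the prime field. -/
def traceChar {ζ : ℂ} (hζ : IsPrimitiveRoot ζ p) : AddChar F ℂ :=
  (AddChar.zmodChar p hζ.pow_eq_one).compAddMonoidHom
    (Algebra.trace (ZMod p) F).toAddMonoidHom

theorem traceChar_apply {ζ : ℂ} (hζ : IsPrimitiveRoot ζ p) (x : F) :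
    traceChar F hζ x = ζ ^ (Algebra.trace (ZMod p) F x).val := rfl

variable {F} [Fintype F]

/-- The Gauss sum `g_q(χ) = ∑ χ(x) ζ ^ Tr(x)` over nonzero `x` in `F`; the term at `x = 0` in
Mathlib's `gaussSum` vanishes because `χ 0 = 0`. -/
def g {ζ : ℂ} (hζ : IsPrimitiveRoot ζ p) (χ : MulChar F ℂ) : ℂ :=
  gaussSum χ (traceChar F hζ)

theorem g_eq_sum_units [DecidableEq F] {ζ : ℂ} (hζ : IsPrimitiveRoot ζ p) (χ : MulChar F ℂ) :
    g hζ χ = ∑ x : Fˣ, χ x * ζ ^ (Algebra.trace (ZMod p) F (x : F)).val := by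
  simp only [g, gaussSum, traceChar_apply]
  rw [← Finset.sum_subset (Finset.subset_univ (Finset.univ.filter (fun x : F => x ≠ 0)))]
  · symm
    refine Finset.sum_bij (fun x _ => (x : F)) (by simp) (fun a _ b _ h => Units.ext h) ?_
      (fun _ _ => rfl)
    intro b hb
    exact ⟨Units.mk0 b (by simpa using hb), by simp, rfl⟩
  · intro x _ hx
    have h0 : x = 0 := by simpa using hx
    rw [h0, MulChar.map_zero, zero_mul]

variable (F) in
open Classical in
/-- The quadratic character of `F` with complex values. -/
def quadChar : MulChar F ℂ := (quadraticChar F).ringHomComp (Int.castRingHom ℂ)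

/-- In odd characteristic, `quadChar F` is the unique character of order two. -/
theorem orderOf_eq_two_iff (hF : ringChar F ≠ 2) (χ : MulChar F ℂ) :
    orderOf χ = 2 ↔ χ = quadChar F := by
  classical
  constructor
  · intro h
    have h2 : χ ^ 2 = 1 := h ▸ pow_orderOf_eq_one χ
    have hne : χ ≠ 1 := by
      rintro rfl
      simp at h
    have hsq : ∀ a : Fˣ, IsSquare (a : F) → χ a = 1 := by
      rintro a ⟨b, hb⟩
      have hb0 : IsUnit b := isUnit_iff_ne_zero.2 (by
        rintro rfl
        exact a.ne_zero (hb.trans (mul_zero 0)))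
      rw [hb, map_mul, ← pow_two, ← MulChar.pow_apply' χ two_ne_zero, h2, MulChar.one_apply hb0]
    obtain ⟨c, hc⟩ := MulChar.ne_one_iff.1 hne
    have hcs : ¬ IsSquare (c : F) := fun hs => hc (hsq c hs)
    have hpm : χ c = -1 := by
      have h1 : χ c ^ 2 = 1 := by
        rw [← MulChar.pow_apply' χ two_ne_zero, h2, MulChar.one_apply c.isUnit]
      rcases mul_eq_zero.1 (show (χ c - 1) * (χ c + 1) = 0 by linear_combination h1) with h | h
      · exact absurd (sub_eq_zero.1 h) hc
      · exact eq_neg_of_add_eq_zero_left h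
    refine MulChar.ext fun a => ?_
    simp only [quadChar, MulChar.ringHomComp_apply, eq_intCast]
    by_cases ha : IsSquare (a : F)
    · rw [hsq a ha, (quadraticChar_one_iff_isSquare a.ne_zero).2 ha, Int.cast_one]
    · have hq : quadraticChar F (a : F) = -1 := quadraticChar_neg_one_iff_not_isSquare.2 ha
      have hqc : quadraticChar F (c : F) = -1 := quadraticChar_neg_one_iff_not_isSquare.2 hcs
      have hac : IsSquare ((a * c : Fˣ) : F) := by
        rw [← quadraticChar_one_iff_isSquare (Units.ne_zero _), Units.val_mul, map_mul, hq, hqc]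
        norm_num
      have h3 := hsq _ hac
      rw [Units.val_mul, map_mul, hpm] at h3
      rw [hq]
      push_cast
      linear_combination -h3
  · rintro rfl
    refine orderOf_eq_prime ?_ ?_
    · refine MulChar.ext fun a => ?_
      rw [MulChar.pow_apply' _ two_ne_zero, MulChar.one_apply a.isUnit]
      simp only [quadChar, MulChar.ringHomComp_apply, eq_intCast]
      exact_mod_cast quadraticChar_sq_one a.ne_zero
    · intro h1
      obtain ⟨a, ha⟩ := quadraticChar_exists_neg_one' hF
      have h4 := congrArg (fun χ : MulChar F ℂ => χ a) h1
      simp only [quadChar, MulChar.ringHomComp_apply, ha, MulChar.one_apply a.isUnit] at h4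
      norm_num at h4

/-- The finite hypergeometric sum `H_q(t)` with `d` upper parameters `1/2` and `d` lower
parameters `1`, computed with the character `ω` and the root of unity `ζ`; here `q = #F`. -/
def H {ζ : ℂ} (hζ : IsPrimitiveRoot ζ p) (ω : MulChar F ℂ) (d : ℕ) (t : F) : ℂ :=
  (-1) ^ d / (1 - (Fintype.card F : ℂ)) *
    ∑ m ∈ Finset.range (Fintype.card F - 1),
      (g hζ (quadChar F * ω ^ m) * g hζ ((ω ^ m)⁻¹) / g hζ (quadChar F)) ^ d *
        ω ((-1) ^ d * t) ^ m

/-- The points with all coordinates in `Fˣ` on the hypersurface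
`∏ (x_i + 2 + x_i⁻¹) = 4 ^ d * t⁻¹`. -/
def X (d : ℕ) (t : Fˣ) : Set (Fin d → Fˣ) :=
  {x | ∏ i, ((x i : F) + 2 + (x i : F)⁻¹) = 4 ^ d * (t : F)⁻¹}

end FiniteHypergeometric

end

open Finset

namespace FiniteHypergeometric

/-! ### Quadratic character, and duality for a generator of the character group. -/

section Characters

variable {F : Type*} [Field F] [Fintype F]

/-! Write `φ` for the quadratic character. Orthogonality over the powers `χ = ω ^ m` gives `(q - 1)
* #X = ∑ χ(t / 4 ^ d) * S(χ) ^ d`, with `S(χ) = ∑ χ(x + 2 + x⁻¹)` over `x ≠ 0` (`card_X_mul`). As `x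
+ 2 + x⁻¹ = y` has `1 + φ(y(y - 4))` solutions, `S(χ)` for `χ ≠ 1` is `χ(4) φ(-1) J(χφ, φ) = χ(-4)
g(φχ) g(χ⁻¹) / g(φ)`. The powers of `4` cancel, leaving exactly the term of `H`. Only `m = 0`
differs: it is `(q - 2) ^ d` in the count and `(-1) ^ d` in the sum for `H`, whence the main term.
-/

theorem quadChar_apply [DecidableEq F] (x : F) : quadChar F x = (quadraticChar F x : ℂ) := by
  simp only [quadChar, MulChar.ringHomComp_apply, eq_intCast]
  congr!

theorem quadChar_sq_one {x : F} (hx : x ≠ 0) : quadChar F x * quadChar F x = 1 := by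
  classical
  rw [quadChar_apply, ← pow_two]
  exact_mod_cast quadraticChar_sq_one hx

theorem quadChar_ne_one (hF : ringChar F ≠ 2) : quadChar F ≠ 1 := fun h => by
  simpa [h] using (orderOf_eq_two_iff hF (quadChar F)).2 rfl

theorem quadChar_mul_self : quadChar F * quadChar F = 1 := by
  refine MulChar.ext fun a => ?_
  rw [MulChar.mul_apply, quadChar_sq_one a.ne_zero, MulChar.one_apply a.isUnit]

theorem inv_quadChar : (quadChar F)⁻¹ = quadChar F :=
  inv_eq_of_mul_eq_one_left quadChar_mul_self

/-- A generator of the character group takes the value `1` only at `1`. -/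
theorem apply_ne_one_of_generator {ω : MulChar F ℂ}
    (hω : ∀ χ : MulChar F ℂ, χ ∈ Subgroup.zpowers ω) {a : Fˣ} (ha : a ≠ 1) : ω a ≠ 1 := by
  intro h
  -- Some character separates `a` from `1`, and it is a power of `ω`.
  obtain ⟨χ, hχ⟩ := MulChar.exists_apply_ne_one_of_hasEnoughRootsOfUnity F ℂ
    (a := (a : F)) (by simpa using ha)
  obtain ⟨k, rfl⟩ := Subgroup.mem_zpowers_iff.1 (hω χ)
  apply hχ
  have h1 : MulChar.toUnitHom ω a = 1 := Units.ext (by simpa [MulChar.coe_toUnitHom] using h)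
  have h2 : ∀ n : ℕ, (ω ^ n) a = 1 := fun n => by
    rw [MulChar.pow_apply_coe, h, one_pow]
  cases k with
  | ofNat n => simpa using h2 n
  | negSucc n =>
    rw [zpow_negSucc, MulChar.inv_apply_eq_inv', h2, inv_one]

/-- A power of a generator of the character group is nontrivial for exponents in
`(0, #F - 1)`. -/
theorem pow_ne_one_of_generator {ω : MulChar F ℂ}
    (hω : ∀ χ : MulChar F ℂ, χ ∈ Subgroup.zpowers ω) {m : ℕ} (hm : m ≠ 0)
    (hm' : m < Fintype.card F - 1) : ω ^ m ≠ 1 := by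
  classical
  intro h
  obtain ⟨a, ha⟩ := IsCyclic.exists_generator (α := Fˣ)
  have hord : orderOf a = Fintype.card F - 1 := by
    rw [orderOf_eq_card_of_forall_mem_zpowers ha, Nat.card_eq_fintype_card, Fintype.card_units]
  have ham : a ^ m ≠ 1 := pow_ne_one_of_lt_orderOf hm (hord ▸ hm')
  apply apply_ne_one_of_generator hω ham
  rw [Units.val_pow_eq_pow_val, map_pow, ← MulChar.pow_apply_coe, h, MulChar.one_apply a.isUnit]

/-- Orthogonality relation for the powers of a generator of the character group. -/
theorem sum_generator_pow_apply [DecidableEq F] {ω : MulChar F ℂ}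
    (hω : ∀ χ : MulChar F ℂ, χ ∈ Subgroup.zpowers ω) (y : F) :
    ∑ m ∈ range (Fintype.card F - 1), (ω ^ m) y
      = if y = 1 then (Fintype.card F : ℂ) - 1 else 0 := by
  have hcard : 1 < Fintype.card F := Fintype.one_lt_card
  split_ifs with h1
  · subst h1
    simp [Nat.cast_sub hcard.le]
  -- At `y = 0` even `m = 0` contributes `0`, since `ω ^ 0` is the trivial character; `(ω 0) ^ 0`
  -- would be `1`.
  · rcases eq_or_ne y 0 with rfl | h0
    · exact sum_eq_zero fun m _ => MulChar.map_zero _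
    lift y to Fˣ using isUnit_iff_ne_zero.2 h0
    simp only [MulChar.pow_apply_coe]
    have hne := apply_ne_one_of_generator hω (a := y) (by simpa using h1)
    rw [geom_sum_eq hne, ← map_pow, FiniteField.pow_card_sub_one_eq_one _ y.ne_zero]
    simp

end Characters

/-! ### Gauss and Jacobi sums. -/

section GaussSums

variable {p : ℕ} [Fact p.Prime] {F : Type*} [Field F] [Fintype F] [Algebra (ZMod p) F]

theorem traceChar_isPrimitive {ζ : ℂ} (hζ : IsPrimitiveRoot ζ p) :
    (traceChar F hζ).IsPrimitive := by
  refine AddChar.IsPrimitive.of_ne_one fun h => ?_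
  obtain ⟨a, ha⟩ := Algebra.trace_surjective (ZMod p) F 1
  have h1 := DFunLike.congr_fun h a
  rw [traceChar_apply, ha, AddChar.one_apply, ZMod.val_one, pow_one] at h1
  exact hζ.ne_one (Fact.out : p.Prime).one_lt h1

theorem card_ne_zero_complex : (Fintype.card F : ℂ) ≠ 0 :=
  Nat.cast_ne_zero.2 Fintype.card_ne_zero

theorem g_ne_zero {ζ : ℂ} (hζ : IsPrimitiveRoot ζ p) {χ : MulChar F ℂ} (hχ : χ ≠ 1) :
    g hζ χ ≠ 0 :=
  gaussSum_ne_zero_of_nontrivial card_ne_zero_complex hχ (traceChar_isPrimitive hζ)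

theorem g_one {ζ : ℂ} (hζ : IsPrimitiveRoot ζ p) : g hζ (1 : MulChar F ℂ) = -1 := by
  refine gaussSum_one_left fun h => ?_
  have h1 := traceChar_isPrimitive (F := F) hζ one_ne_zero
  rw [AddChar.mulShift_one] at h1
  exact h1 h

omit [Fintype F] in
theorem apply_neg_one_mul_self (χ : MulChar F ℂ) : χ (-1) * χ (-1) = 1 := by
  rw [← map_mul, neg_mul_neg, one_mul, map_one]

/-- The classical product pairs `ψ` with `ψ⁻¹`; returning to `ψ` costs the sign `χ (-1)`. -/
theorem g_mul_g_inv {ζ : ℂ} (hζ : IsPrimitiveRoot ζ p) {χ : MulChar F ℂ} (hχ : χ ≠ 1) :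
    g hζ χ * g hζ χ⁻¹ = χ (-1) * Fintype.card F := by
  have h1 := gaussSum_mul_gaussSum_eq_card hχ (traceChar_isPrimitive (F := F) hζ)
  have h2 := mul_gaussSum_inv_eq_gaussSum χ⁻¹ (traceChar F hζ)
  have h3 : χ⁻¹ (-1) = χ (-1) := by rw [MulChar.inv_apply', inv_neg_one]
  rw [h3] at h2
  rw [g, g, ← h2, ← h1]
  ring

/-- The Jacobi sum `J(χφ, φ)`, for `φ` the quadratic character, in terms of Gauss sums. -/
theorem jacobiSum_mul_quadChar {ζ : ℂ} (hζ : IsPrimitiveRoot ζ p) (hF : ringChar F ≠ 2)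
    {χ : MulChar F ℂ} (hχ : χ ≠ 1) :
    quadChar F (-1) * jacobiSum (χ * quadChar F) (quadChar F)
      = χ (-1) * (g hζ (quadChar F * χ) * g hζ χ⁻¹ / g hζ (quadChar F)) := by
  have hB := g_ne_zero hζ (quadChar_ne_one hF)
  have hC := g_ne_zero hζ hχ
  have hCD := g_mul_g_inv hζ hχ
  have hBB := g_mul_g_inv hζ (quadChar_ne_one hF)
  rw [inv_quadChar] at hBB
  have hmul : χ * quadChar F * quadChar F = χ := by rw [mul_assoc, quadChar_mul_self, mul_one]
  have hJ := jacobiSum_mul_nontrivial (χ := χ * quadChar F) (φ := quadChar F)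
    (by rwa [hmul]) (traceChar F hζ)
  rw [hmul] at hJ
  change g hζ χ * _ = g hζ _ * g hζ _ at hJ
  rw [mul_comm (quadChar F) χ, ← mul_div_assoc, eq_div_iff hB]
  -- After multiplying by `g(χ)`, both `g(χ) g(χ⁻¹)` and `g(φ) ^ 2` are signs times `q`.
  refine mul_left_cancel₀ hC ?_
  have e1 := apply_neg_one_mul_self (quadChar F)
  have e2 := apply_neg_one_mul_self χ
  linear_combination (quadChar F (-1) * g hζ (quadChar F)) * hJ +
    quadChar F (-1) * g hζ (χ * quadChar F) * hBB - χ (-1) * g hζ (χ * quadChar F) * hCD +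
    g hζ (χ * quadChar F) * Fintype.card F * (e1 - e2)

end GaussSums

/-! ### Fibres of `x + 2 + x⁻¹` and the count. -/

section PointCount

variable {F : Type*} [Field F] [Fintype F] [DecidableEq F]

omit [Fintype F] [DecidableEq F] in
theorem four_ne_zero_of_ringChar (hF : ringChar F ≠ 2) : (4 : F) ≠ 0 := by
  have h2 : (2 : F) ≠ 0 := Ring.two_ne_zero hF
  rw [show (4 : F) = 2 * 2 by norm_num]
  exact mul_ne_zero h2 h2

/-- The number of `x` in `Fˣ` with `x + 2 + x⁻¹ = y` is `1 + φ(y(y - 4))`. -/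
theorem card_add_two_add_inv_eq (hF : ringChar F ≠ 2) (y : F) :
    (#{x : Fˣ | (x : F) + 2 + (x : F)⁻¹ = y} : ℂ) = 1 + quadChar F (y * (y - 4)) := by
  have h2 : (2 : F) ≠ 0 := Ring.two_ne_zero hF
  have h := quadraticChar_card_sqrts hF (y * (y - 4))
  have hcard : #{x : Fˣ | (x : F) + 2 + (x : F)⁻¹ = y}
      = #({z : F | z ^ 2 = y * (y - 4)} : Set F).toFinset := by
    -- Completing the square in `x ^ 2 + (2 - y) * x + 1`, whose discriminant is `y * (y - 4)`.
    refine card_bij (fun x _ => 2 * (x : F) + 2 - y) ?_ ?_ ?_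
    · intro x hx
      rw [mem_filter_univ] at hx
      rw [Set.mem_toFinset, Set.mem_ofPred_eq, ← hx]
      field_simp
      ring
    · intro a _ b _ hab
      exact Units.ext (mul_left_cancel₀ h2 (by linear_combination hab))
    · intro z hz
      rw [Set.mem_toFinset, Set.mem_ofPred_eq] at hz
      have hx0 : (z + y - 2) / 2 ≠ 0 := by
        intro h0
        have hz' : z = 2 - y := by
          rw [div_eq_zero_iff, or_iff_left h2] at h0
          linear_combination h0
        rw [hz'] at hz
        exact mul_ne_zero h2 h2 (by linear_combination hz)
      refine ⟨Units.mk0 _ hx0, ?_, ?_⟩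
      · have hz0 : z + y - 2 ≠ 0 := fun h0 => hx0 (by rw [h0, zero_div])
        rw [mem_filter_univ, Units.val_mk0]
        field_simp
        linear_combination hz
      · rw [Units.val_mk0]
        field_simp
        ring
  rw [hcard, quadChar_apply]
  have h' := congrArg (Int.cast : ℤ → ℂ) h
  push_cast at h'
  rw [h', add_comm]

theorem sum_apply_add_two_add_inv (hF : ringChar F ≠ 2) (χ : MulChar F ℂ) :
    ∑ x : Fˣ, χ ((x : F) + 2 + (x : F)⁻¹) =
      ∑ y, χ y + χ 4 * (quadChar F (-1) * jacobiSum (χ * quadChar F) (quadChar F)) := by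
  have h4 : (4 : F) ≠ 0 := four_ne_zero_of_ringChar hF
  have h1 : ∑ x : Fˣ, χ ((x : F) + 2 + (x : F)⁻¹)
      = ∑ y, (1 + quadChar F (y * (y - 4))) * χ y := by
    rw [← sum_fiberwise (g := fun x : Fˣ => (x : F) + 2 + (x : F)⁻¹)]
    refine sum_congr rfl fun y _ => ?_
    rw [← card_add_two_add_inv_eq hF, ← nsmul_eq_mul]
    refine sum_eq_card_nsmul fun x hx => ?_
    rw [(mem_filter.1 hx).2]
  -- Scaling `y = 4u` turns `y - 4` into `-4(1 - u)`, the shape of a Jacobi sum.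
  have h2 : ∑ y, quadChar F (y * (y - 4)) * χ y
      = ∑ u, quadChar F (4 * u * (4 * u - 4)) * χ (4 * u) :=
    ((Equiv.mulLeft₀ (4 : F) h4).bijective.sum_comp
      fun y => quadChar F (y * (y - 4)) * χ y).symm
  simp only [h1, add_mul, one_mul, sum_add_distrib, h2, jacobiSum, mul_sum]
  congr 1
  refine sum_congr rfl fun u _ => ?_
  rw [show 4 * u * (4 * u - 4) = 4 * 4 * u * (-1 * (1 - u)) by ring]
  simp only [map_mul, MulChar.mul_apply]
  rw [quadChar_sq_one h4]
  ring

/-- Since `x + 2 + x⁻¹ = (x + 1) ^ 2 / x`, only `x = -1` is lost among the `q - 1` units; here this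
comes out of `J(φ, φ) = -φ(-1)`. -/
theorem sum_one_apply_add_two_add_inv (hF : ringChar F ≠ 2) :
    ∑ x : Fˣ, (1 : MulChar F ℂ) ((x : F) + 2 + (x : F)⁻¹) = (Fintype.card F : ℂ) - 2 := by
  have hJ := jacobiSum_nontrivial_inv (quadChar_ne_one hF)
  rw [inv_quadChar] at hJ
  have h4 : (1 : MulChar F ℂ) 4 = 1 := MulChar.one_apply (four_ne_zero_of_ringChar hF).isUnit
  rw [sum_apply_add_two_add_inv hF, one_mul, hJ, MulChar.sum_one_eq_card_units,
    Fintype.card_units, Nat.cast_sub Fintype.card_pos, h4]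
  linear_combination -apply_neg_one_mul_self (quadChar F)

/-- The number of points of `X d t` as a sum over the powers of a generator of the character
group. -/
theorem card_X_mul {ω : MulChar F ℂ} (hω : ∀ χ : MulChar F ℂ, χ ∈ Subgroup.zpowers ω)
    (hF : ringChar F ≠ 2) (d : ℕ) (t : Fˣ) :
    ((X d t).ncard : ℂ) * ((Fintype.card F : ℂ) - 1) =
      ∑ m ∈ range (Fintype.card F - 1), (ω ^ m) ((4 ^ d)⁻¹ * t) *
        (∑ x : Fˣ, (ω ^ m) ((x : F) + 2 + (x : F)⁻¹)) ^ d := by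
  have h4 : (4 : F) ≠ 0 := four_ne_zero_of_ringChar hF
  -- The `d`-th power opens into a sum over `d`-tuples, on which orthogonality detects the equation.
  simp only [Fintype.sum_pow, mul_sum, ← map_prod, ← map_mul]
  rw [sum_comm]
  simp only [sum_generator_pow_apply hω]
  rw [sum_ite, sum_const_zero, add_zero, sum_const, nsmul_eq_mul, X, Set.ncard_eq_toFinset_card']
  congr 3
  ext x
  rw [Set.mem_toFinset, Set.mem_ofPred_eq, mem_filter_univ]
  have ht := t.ne_zero
  field_simp

/-- The point count of `X d t`, including `d ≤ 1`. -/
theorem ncard_X {p : ℕ} [Fact p.Prime] [Algebra (ZMod p) F] (hF : ringChar F ≠ 2)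
    {ζ : ℂ} (hζ : IsPrimitiveRoot ζ p) {ω : MulChar F ℂ}
    (hω : ∀ χ : MulChar F ℂ, χ ∈ Subgroup.zpowers ω) (d : ℕ) (t : Fˣ) :
    ((X d t).ncard : ℂ) =
      (((Fintype.card F : ℂ) - 2) ^ d - (-1) ^ d) / ((Fintype.card F : ℂ) - 1) -
        (-1) ^ d * H hζ ω d (t : F) := by
  have h4 : (4 : F) ≠ 0 := four_ne_zero_of_ringChar hF
  have hcard : 1 < Fintype.card F := Fintype.one_lt_card
  have hq1 : (Fintype.card F : ℂ) - 1 ≠ 0 := sub_ne_zero.2 (by exact_mod_cast hcard.ne')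
  have hq2 : 1 - (Fintype.card F : ℂ) ≠ 0 := sub_ne_zero.2 (by exact_mod_cast hcard.ne)
  have hsgn : ((-1 : ℂ) ^ d) * (-1) ^ d = 1 := by rw [← mul_pow]; norm_num
  obtain ⟨n, hn⟩ : ∃ n, Fintype.card F - 1 = n + 1 := ⟨Fintype.card F - 2, by omega⟩
  have hφ := g_ne_zero hζ (quadChar_ne_one hF)
  have hterm : ∀ m ∈ range n, (ω ^ (m + 1)) ((4 ^ d)⁻¹ * t) *
        (∑ x : Fˣ, (ω ^ (m + 1)) ((x : F) + 2 + (x : F)⁻¹)) ^ d =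
      (g hζ (quadChar F * ω ^ (m + 1)) * g hζ ((ω ^ (m + 1))⁻¹) / g hζ (quadChar F)) ^ d *
        ω ((-1) ^ d * t) ^ (m + 1) := by
    intro m hm
    have hne := pow_ne_one_of_generator hω m.succ_ne_zero (by have := mem_range.1 hm; omega)
    rw [← MulChar.pow_apply' ω m.succ_ne_zero ((-1) ^ d * (t : F)),
      sum_apply_add_two_add_inv hF, MulChar.sum_eq_zero_of_ne_one hne, zero_add,
      jacobiSum_mul_quadChar hζ hF hne, ← inv_pow]
    simp only [map_mul, map_pow, mul_pow]
    have h44 : (ω ^ (m + 1)) (4 : F)⁻¹ ^ d * (ω ^ (m + 1)) (4 : F) ^ d = 1 := by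
      rw [← mul_pow, ← map_mul, inv_mul_cancel₀ h4, map_one, one_pow]
    linear_combination ((ω ^ (m + 1)) (t : F) * (ω ^ (m + 1)) (-1) ^ d *
      (g hζ (quadChar F * ω ^ (m + 1)) * g hζ ((ω ^ (m + 1))⁻¹) / g hζ (quadChar F)) ^ d) * h44
  have hN := card_X_mul hω hF d t
  rw [hn, sum_range_succ', sum_congr rfl hterm, pow_zero, sum_one_apply_add_two_add_inv hF,
    MulChar.one_apply (mul_ne_zero (inv_ne_zero (pow_ne_zero d h4)) t.ne_zero).isUnit,
    one_mul] at hN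
  rw [H, hn, sum_range_succ']
  -- At `m = 0` the Gauss sum quotient is `g(1) = -1`.
  simp only [pow_zero, mul_one, inv_one, g_one]
  rw [mul_neg_one, neg_div, div_self hφ, eq_sub_iff_add_eq, eq_div_iff hq1, add_mul, hN]
  generalize (∑ m ∈ range n, (_ : ℂ)) = S
  have hdiv : ((-1 : ℂ) ^ d / (1 - (Fintype.card F : ℂ))) * ((Fintype.card F : ℂ) - 1)
      = -(-1) ^ d := by
    field_simp
    ring
  linear_combination (-1) ^ d * (S + (-1) ^ d) * hdiv - (S + (-1) ^ d) * hsgn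

end PointCount

end FiniteHypergeometric

theorem mainTheorem3 {p : ℕ} [Fact p.Prime] (hp : p ≠ 2)
    {F : Type*} [Field F] [Fintype F] [Algebra (ZMod p) F]
    {q : ℕ} (hq : Fintype.card F = q)
    {ζ : ℂ} (hζ : IsPrimitiveRoot ζ p)
    (ω : MulChar F ℂ) (hω : ∀ χ : MulChar F ℂ, χ ∈ Subgroup.zpowers ω)
    (d : ℕ) (hd : 2 ≤ d) (t : Fˣ) :
    ((FiniteHypergeometric.X d t).ncard : ℂ) =
      (((q : ℂ) - 2) ^ d - (-1) ^ d) / ((q : ℂ) - 1) -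
        (-1) ^ d * FiniteHypergeometric.H hζ ω d (t : F) := by
  classical
  subst hq
  have : CharP F p := charP_of_injective_algebraMap' (ZMod p) p
  exact FiniteHypergeometric.ncard_X (by rwa [ringChar.eq F p]) hζ hω d t
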